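/- Let $A$ be a (not necessarily unital) $C^*$-algebra with multiplier algebra $M(A)$, and let $S$ be an abelian semigroup with identity $0$, written additively. Let $\alpha$ be an action of $S$ on $A$ by $*$-endomorphisms, so $\alpha_0=\mathrm{id}$ and $\alpha_{s+t}=\alpha_s\circ\alpha_t$. Assume that each $\alpha_s$ is extendible: it extends to an endomorphism $\overline{\alpha_s}$ of $M(A)$ such that $\overline{\alpha_s}(1)$ is the strict limit of $\alpha_s(u_\lambda)$ for some approximate unit $(u_\lambda)$ of $A$. Let $L$ be an action of $S$ by continuous positive linear maps $L_s:A\to A$, so $L_0=\mathrm{id}$ and $L_{s+t}=L_s\circ L_t$, which have continuous linear extensions $\overline{L_s}:M(A)\to M(A)$ with $$L_s(\alpha_s(a)u)=a\,\overline{L_s}(u)\qquad (a\in A,\ u\in M(A),\ s\in S).$$ For $s\in S$ put $A_s:=A\,\overline{\alpha_s}(1)\subseteq A$, with right action $x\cdot a:=x\alpha_s(a)$, left action $a\cdot x:=ax$ and $A$-valued pre-inner product $\langle x,y\rangle_s:=L_s(x^*y)$. Let $M_s$ be the Hilbert bimodule over $A$ obtained from $A_s$ by dividing out the vectors of length zero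 and completing. Let $X_s:=\{s\}\times M_s$ and $X:=\bigsqcup_{s\in S}X_s$, with the product that is given by $$(s,\,a\overline{\alpha_s}(1))\,(t,\,b\overline{\alpha_t}(1)):=\bigl(s+t,\;a\,\alpha_s(b\,\overline{\alpha_t}(1))\bigr)\qquad(a,b\in A)$$ and extended continuously to $M_s\times M_t\to M_{s+t}$ for all $s,t\in S$. Then $X$ is a product system of Hilbert bimodules over $A$, over the semigroup $S$. That is: 1. the product on $X$ is associative, and $(s,x)\mapsto s$ is a semigroup homomorphism $X\to S$; 2. for all $s,t\in S\setminus\{0\}$ the map $(x,y)\mapsto xy$, $X_s\times X_t\to X_{s+t}$, extends to an isomorphism $X_s\otimes_A X_t\cong X_{s+t}$ of Hilbert bimodules, where $\otimes_A$ is the internal tensor product; 3. the map $a\mapsto(0,\,a\overline{\alpha_0}(1))$ is an isomorphism of Hilbert bimodules of $A$ (with $\langle a,b\rangle=a^*b$ and multiplication as left and right action) onto $X_0$, and, with $A$ identified with $X_0$ in this way, $ax=a\cdot x$ and $xa=x\cdot a$ for all $s\in S$, $a\in A$, $x\in X_s$. Moreover every fibre is essential: $X_s=\overline{\operatorname{span}}\{a\cdot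 x: a\in A,\ x\in X_s\}$ for all $s\in S$. -/

import Mathlib

noncomputable section

open scoped MultiplierAlgebra TensorProduct Topology
open Filter

/-- A semi-inner-product (right) `A`-module `E` over a C⋆-algebra `A` together with a left action
of `A`, before completion:
`ip x y` is the `A`-valued form `⟨x, y⟩`, conjugate-linear in `x` and linear in `y`;
`right x a` is the right action `x · a`; `left a x` is the left action `a · x`, a homomorphism
of `A` into the linear operators such that `left (star a)` is an adjoint of `left a`. -/
class PreHilbertBimodule (A : Type*) [NonUnitalCStarAlgebra A] [PartialOrder A]
    (E : Type*) [AddCommGroup E] [Module ℂ E] where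
  ip : E →ₗ⋆[ℂ] E →ₗ[ℂ] A
  star_ip : ∀ x y, star (ip x y) = ip y x
  ip_self_nonneg : ∀ x, 0 ≤ ip x x
  right : E →ₗ[ℂ] A →ₗ[ℂ] E
  right_mul : ∀ x a b, right x (a * b) = right (right x a) b
  ip_right : ∀ x y a, ip x (right y a) = ip x y * a
  left : A →ₙₐ[ℂ] Module.End ℂ E
  ip_left : ∀ a x y, ip (left a x) y = ip x (left (star a) y)

/-- A Hilbert bimodule over `A`: a right Hilbert `A`-module `E` (complete in the norm
`‖x‖ = ‖⟨x, x⟩‖ ^ (1/2)`) with a left action of `A` by adjointable operators, that is, with a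
`⋆`-homomorphism `a ↦ left a` of `A` into the adjointable operators on `E`. -/
class HilbertBimodule (A : Type*) [NonUnitalCStarAlgebra A] [PartialOrder A]
    (E : Type*) [NormedAddCommGroup E] [NormedSpace ℂ E] extends PreHilbertBimodule A E where
  norm_sq : ∀ x : E, ‖x‖ ^ 2 = ‖ip x x‖
  complete : CompleteSpace E

namespace PreHilbertBimodule

variable (A : Type*) [NonUnitalCStarAlgebra A] [PartialOrder A]

section Semi
variable (E : Type*) [AddCommGroup E] [Module ℂ E] [PreHilbertBimodule A E]

/-- `E` with the seminorm `‖x‖ = ‖⟨x, x⟩‖ ^ (1/2)`. -/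
def Semi (_A E : Type*) : Type _ := E

instance : AddCommGroup (Semi A E) := inferInstanceAs (AddCommGroup E)
instance : Module ℂ (Semi A E) := inferInstanceAs (Module ℂ E)
instance : PreHilbertBimodule A (Semi A E) := inferInstanceAs (PreHilbertBimodule A E)

variable {A E}

theorem ip_right_left (x y : E) (a : A) : ip (right x a) y = star a * ip (A := A) x y := by
  rw [← star_ip, ip_right, star_mul, star_ip]

variable [StarOrderedRing A]

theorem cauchy_schwarz (x y : E) :
    ‖ip (A := A) x y‖ ^ 2 ≤ ‖ip (A := A) x x‖ * ‖ip (A := A) y y‖ := by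
  have key : ∀ c : ℝ, ‖ip (A := A) x x‖ < c →
      ‖ip (A := A) x y‖ ^ 2 ≤ c * ‖ip (A := A) y y‖ := by
    intro c hc
    have hc0 : 0 < c := (norm_nonneg _).trans_lt hc
    set a := ip (A := A) x y with ha
    have ha' : ip (A := A) y x = star a := by rw [ha, star_ip]
    have h0 := ip_self_nonneg (A := A) (right x a - (c : ℂ) • y)
    have h1 : ip (A := A) (right x a - (c : ℂ) • y) (right x a - (c : ℂ) • y)
        = star a * ip x x * a - c • (star a * a) - c • (star a * a)
          + c • (c • ip (A := A) y y) := by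
      rw [map_sub, map_sub, LinearMap.sub_apply, LinearMap.sub_apply, LinearMap.map_smulₛₗ,
        LinearMap.smul_apply, LinearMap.smul_apply, map_smul, map_smul, ip_right, ip_right,
        ip_right_left, ip_right_left, ha', ← ha, Complex.conj_ofReal]
      simp only [Complex.coe_smul]
      abel
    have h2 : star a * ip x x * a ≤ c • (star a * a) := by
      refine (CStarAlgebra.star_left_conjugate_le_norm_smul
        (hb := IsSelfAdjoint.of_nonneg (ip_self_nonneg x))).trans ?_
      exact smul_le_smul_of_nonneg_right hc.le (star_mul_self_nonneg a)
    have h3 : c • (star a * a) ≤ c • (c • ip (A := A) y y) := by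
      rw [h1] at h0
      have := h0.trans (add_le_add_left (sub_le_sub_right (sub_le_sub_right h2 _) _) _)
      rw [sub_self, zero_sub] at this
      simpa using this
    have h4 : star a * a ≤ c • ip (A := A) y y := by
      rwa [smul_le_smul_iff_of_pos_left hc0] at h3
    have h5 := CStarAlgebra.norm_le_norm_of_nonneg_of_le (star_mul_self_nonneg a) h4
    rwa [CStarRing.norm_star_mul_self, norm_smul, Real.norm_of_nonneg hc0.le, ← sq] at h5
  refine le_of_forall_gt_imp_ge_of_dense ?_ |>.trans le_rfl
  intro b hb
  have : Tendsto (fun c : ℝ => c * ‖ip (A := A) y y‖) (𝓝[>] ‖ip (A := A) x x‖)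
    (𝓝 (‖ip (A := A) x x‖ * ‖ip (A := A) y y‖)) :=
    ((continuous_mul_const _).tendsto _).mono_left nhdsWithin_le_nhds
  exact (ge_of_tendsto this (eventually_nhdsWithin_of_forall fun c hc => key c hc)).trans hb.le

variable (A) in
theorem seminorm_core_triangle (x y : E) :
    √‖ip (A := A) (x + y) (x + y)‖ ≤ √‖ip (A := A) x x‖ + √‖ip (A := A) y y‖ := by
  have h : ‖ip (A := A) x y‖ ≤ √‖ip (A := A) x x‖ * √‖ip (A := A) y y‖ := by
    rw [← Real.sqrt_mul (norm_nonneg _)]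
    exact Real.le_sqrt_of_sq_le (cauchy_schwarz x y)
  have h' : ‖ip (A := A) y x‖ = ‖ip (A := A) x y‖ := by rw [← star_ip, norm_star]
  apply Real.sqrt_le_iff.2 ⟨by positivity, ?_⟩
  have e : ip (A := A) (x + y) (x + y) = ip x x + ip x y + ip y x + ip y y := by
    simp only [map_add, LinearMap.add_apply]; abel
  rw [e]
  have n1 := norm_add_le (ip (A := A) x x + ip x y + ip y x) (ip y y)
  have n2 := norm_add₃_le (a := ip (A := A) x x) (b := ip x y) (c := ip y x)
  have s1 := Real.sq_sqrt (norm_nonneg (ip (A := A) x x))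
  have s2 := Real.sq_sqrt (norm_nonneg (ip (A := A) y y))
  nlinarith

variable (A E) in
instance : SeminormedAddCommGroup (Semi A E) :=
  letI : Norm (Semi A E) := ⟨fun x => √‖ip (A := A) x x‖⟩
  SeminormedAddCommGroup.ofCore (𝕜 := ℂ)
    { norm_nonneg := fun x => Real.sqrt_nonneg _
      norm_smul := fun c x => by
        change √‖ip (A := A) (E := Semi A E) (c • x) (c • x)‖ = _ * √‖ip (A := A) x x‖
        rw [map_smul, LinearMap.map_smulₛₗ, LinearMap.smul_apply, norm_smul, norm_smul,
          RCLike.norm_conj, ← mul_assoc, Real.sqrt_mul (by positivity),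
          Real.sqrt_mul_self (norm_nonneg _)]
      norm_triangle := fun x y => seminorm_core_triangle A x y }

theorem Semi.norm_def (x : Semi A E) : ‖x‖ = √‖ip (A := A) x x‖ := rfl

theorem Semi.norm_sq (x : Semi A E) : ‖x‖ ^ 2 = ‖ip (A := A) x x‖ := by
  rw [Semi.norm_def, Real.sq_sqrt (norm_nonneg _)]

instance : NormedSpace ℂ (Semi A E) where
  norm_smul_le c x := by
    rw [Semi.norm_def, Semi.norm_def, map_smul, LinearMap.map_smulₛₗ, LinearMap.smul_apply,
      norm_smul, norm_smul, RCLike.norm_conj, ← mul_assoc, Real.sqrt_mul (by positivity),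
          Real.sqrt_mul_self (norm_nonneg _)]

theorem Semi.norm_ip_le (x y : Semi A E) : ‖ip (A := A) x y‖ ≤ ‖x‖ * ‖y‖ := by
  rw [Semi.norm_def, Semi.norm_def, ← Real.sqrt_mul (norm_nonneg _)]
  exact Real.le_sqrt_of_sq_le (cauchy_schwarz x y)

theorem Semi.norm_right_le (x : Semi A E) (a : A) : ‖right x a‖ ≤ ‖x‖ * ‖a‖ := by
  refine le_of_sq_le_sq ?_ (by positivity)
  rw [Semi.norm_sq, mul_pow, Semi.norm_sq, ip_right, ip_right_left]
  calc _ ≤ ‖star a‖ * ‖ip (A := A) x x‖ * ‖a‖ := by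
        refine (norm_mul_le _ _).trans ?_
        gcongr
        exact norm_mul_le _ _
    _ = _ := by rw [norm_star]; ring


theorem ip_lift_left (u : Unitization ℂ A) (x y : E) :
    ip (A := A) (Unitization.lift (left (A := A) (E := E)) u x) y
      = ip x (Unitization.lift (left (A := A) (E := E)) (star u) y) := by
  induction u with
  | inl_add_inr r a =>
    simp [Unitization.lift_apply, ip_left, Algebra.algebraMap_eq_smul_one]

theorem ip_left_le (a : A) (x : E) :
    ip (A := A) (left a x) (left a x) ≤ (‖a‖ ^ 2) • ip (A := A) x x := by
  have h := CStarAlgebra.star_mul_le_algebraMap_norm_sq (a := (a : Unitization ℂ A))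
  obtain ⟨c, hc⟩ := CStarAlgebra.nonneg_iff_eq_star_mul_self.1 (sub_nonneg.2 h)
  have h1 := ip_self_nonneg (A := A) (Unitization.lift (left (A := A) (E := E)) c x)
  rw [ip_lift_left, ← Module.End.mul_apply, ← map_mul, ← hc] at h1
  rw [← sub_nonneg]
  convert h1 using 1
  have : algebraMap ℝ (Unitization ℂ A) (‖(a : Unitization ℂ A)‖ ^ 2) =
    algebraMap ℂ _ ((‖a‖ ^ 2 : ℝ) : ℂ) := by
    rw [Unitization.norm_inr]; rfl
  rw [this, map_sub, AlgHom.commutes, map_mul, LinearMap.sub_apply, Module.End.mul_apply,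
    map_sub, ip_left]
  simp [Unitization.lift_apply, Algebra.algebraMap_eq_smul_one,
    -Complex.ofReal_pow, -Unitization.inr_star]

theorem Semi.norm_left_le (a : A) (x : Semi A E) : ‖left a x‖ ≤ ‖a‖ * ‖x‖ := by
  refine le_of_sq_le_sq ?_ (by positivity)
  rw [Semi.norm_sq, mul_pow, Semi.norm_sq]
  refine (CStarAlgebra.norm_le_norm_of_nonneg_of_le (ip_self_nonneg _) (ip_left_le a x)).trans ?_
  rw [norm_smul, Real.norm_of_nonneg (by positivity)]

end Semi


section Matrix

theorem nonneg_criterion {B : Type*} [NonUnitalCStarAlgebra B] [PartialOrder B] [StarOrderedRing B]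
    (G : B) (hG : IsSelfAdjoint G) :
    ∃ h s : B, star h * G * h = - (star s * s) ∧ (s = 0 → 0 ≤ G) := by
  have hn : 0 ≤ G⁻ := CFC.negPart_nonneg G
  have hs : star G⁻ = G⁻ := hn.isSelfAdjoint
  have h3 : 0 ≤ star G⁻ * G⁻ * G⁻ := star_left_conjugate_nonneg hn _
  obtain ⟨s, hs'⟩ := CStarAlgebra.nonneg_iff_eq_star_mul_self.1 h3
  refine ⟨G⁻, s, ?_, ?_⟩
  · rw [← hs', hs]
    conv_lhs => enter [1, 2]; rw [← CFC.posPart_sub_negPart G hG]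
    rw [mul_sub, CFC.negPart_mul_posPart, zero_sub, neg_mul]
  · rintro rfl
    rw [hs, star_zero, zero_mul] at hs'
    have h4 : star (G⁻ * G⁻) * (G⁻ * G⁻) = 0 := by
      rw [star_mul, hs, ← mul_assoc, hs', zero_mul]
    rw [CStarRing.star_mul_self_eq_zero_iff] at h4
    have h5 : star G⁻ * G⁻ = 0 := by rw [hs, h4]
    rw [CStarRing.star_mul_self_eq_zero_iff] at h5
    rwa [CFC.negPart_eq_zero_iff G hG] at h5

theorem exists_star_mul_self {B : Type*} [NonUnitalCStarAlgebra B] [PartialOrder B] [StarOrderedRing B]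
    (G : B) (hG : 0 ≤ G) : ∃ c, G = star c * c := CStarAlgebra.nonneg_iff_eq_star_mul_self.1 hG

variable {A} [StarOrderedRing A]
variable {E : Type*} [AddCommGroup E] [Module ℂ E] [PreHilbertBimodule A E]

theorem gram_nonneg {n : Type*} [Fintype n] (x : n → E) :
    0 ≤ (CStarMatrix.ofMatrix (Matrix.of fun i j => ip (A := A) (x i) (x j))
      : CStarMatrix n n A) := by
  set G := (CStarMatrix.ofMatrix (Matrix.of fun i j => ip (A := A) (x i) (x j))
      : CStarMatrix n n A) with hG
  have hsa : IsSelfAdjoint G := by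
    ext i j
    rw [CStarMatrix.star_apply]
    exact star_ip _ _
  obtain ⟨h, s, h1, h2⟩ := nonneg_criterion G hsa
  refine h2 ?_
  have key : ∀ j k, s k j = 0 := by
    intro j
    have e1 : (star h * G * h) j j =
        ip (A := A) (∑ k, right (x k) (h k j)) (∑ k, right (x k) (h k j)) := by
      simp only [CStarMatrix.mul_apply, CStarMatrix.star_apply, map_sum, LinearMap.sum_apply,
        ip_right, ip_right_left, Finset.sum_mul]
      rfl
    have e2 : (star s * s) j j = ∑ k, star (s k j) * s k j := by
      simp only [CStarMatrix.mul_apply, CStarMatrix.star_apply]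
    have e3 : ∑ k, star (s k j) * s k j = 0 := by
      refine le_antisymm ?_ (Finset.sum_nonneg fun k _ => star_mul_self_nonneg _)
      rw [← e2, ← neg_nonneg]
      have := congrFun (congrFun h1 j) j
      rw [e1] at this
      have h' := ip_self_nonneg (A := A) (∑ k, right (x k) (h k j))
      rw [this] at h'
      exact h'
    intro k
    have := (Finset.sum_eq_zero_iff_of_nonneg (fun k _ => star_mul_self_nonneg (s k j))).1 e3 k
      (Finset.mem_univ k)
    rwa [CStarRing.star_mul_self_eq_zero_iff] at this
  ext k j
  exact key j k

theorem sum_gram_nonneg {F : Type*} [AddCommGroup F] [Module ℂ F] [PreHilbertBimodule A F]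
    {n : Type*} [Fintype n] (x : n → E) (y : n → F) :
    0 ≤ ∑ i, ∑ j, ip (A := A) (y i) (left (ip (A := A) (x i) (x j)) (y j)) := by
  obtain ⟨c, hc⟩ := exists_star_mul_self _ (gram_nonneg (A := A) x)
  have hc' : ∀ i j, ip (A := A) (x i) (x j) = ∑ k, star (c k i) * c k j := by
    intro i j
    have := congrFun (congrFun hc i) j
    rw [CStarMatrix.mul_apply] at this
    simp only [CStarMatrix.star_apply] at this
    exact this
  have : ∑ i, ∑ j, ip (A := A) (y i) (left (ip (A := A) (x i) (x j)) (y j)) =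
      ∑ k, ip (A := A) (∑ i, left (c k i) (y i)) (∑ j, left (c k j) (y j)) := by
    simp only [hc', map_sum, LinearMap.sum_apply, map_mul, Module.End.mul_apply, ip_left]
    rw [Finset.sum_comm]
    simp_rw [fun j => Finset.sum_comm (s := Finset.univ) (t := Finset.univ)
      (f := fun i k => ip (A := A) (y i) (left (star (c k i)) (left (c k j) (y j))))]
    rw [Finset.sum_comm]
  rw [this]
  exact Finset.sum_nonneg fun k _ => ip_self_nonneg _

end Matrix

section Tensor
variable {A}
variable (E F : Type*) [AddCommGroup E] [Module ℂ E] [PreHilbertBimodule A E]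
 [AddCommGroup F] [Module ℂ F] [PreHilbertBimodule A F]

/-- The form `⟨x ⊗ y, x' ⊗ y'⟩ = ⟨y, ⟨x, x'⟩ · y'⟩` on the algebraic tensor product. -/
def tensorIp : (E ⊗[ℂ] F) →ₗ⋆[ℂ] (E ⊗[ℂ] F) →ₗ[ℂ] A :=
  TensorProduct.lift <| LinearMap.mk₂'ₛₗ _ _
    (fun x y => TensorProduct.lift <| LinearMap.mk₂ ℂ
      (fun x' y' => ip (A := A) y (left (ip (A := A) x x') y'))
      (by intros; simp) (by intros; simp) (by intros; simp) (by intros; simp))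
    (by intros; ext; simp) (by intros; ext; simp) (by intros; ext; simp) (by intros; ext; simp)

variable [StarOrderedRing A]

/-- The algebraic tensor product, with `(x ⊗ y) · a = x ⊗ (y · a)` and
`a · (x ⊗ y) = (a · x) ⊗ y`. -/
instance : PreHilbertBimodule A (E ⊗[ℂ] F) where
  ip := tensorIp E F
  star_ip z w := by
    induction z with
    | zero => simp
    | add a b ha hb => simp [ha, hb]
    | tmul x y =>
      induction w with
      | zero => simp
      | add a b ha hb => simp [ha, hb]
      | tmul x' y' => simp [tensorIp, star_ip, ip_left]
  ip_self_nonneg z := by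
    obtain ⟨s, rfl⟩ := TensorProduct.exists_finset z
    have := sum_gram_nonneg (A := A) (fun i : s => i.1.1) (fun i : s => i.1.2)
    rw [← Finset.sum_coe_sort]
    rw [Finset.sum_comm] at this
    simpa only [map_sum, LinearMap.sum_apply, tensorIp, TensorProduct.lift.tmul,
      LinearMap.mk₂'ₛₗ_apply, LinearMap.mk₂_apply] using this
  right := TensorProduct.lift <| LinearMap.mk₂ ℂ
    (fun x y => (TensorProduct.mk ℂ E F x) ∘ₗ right y)
    (by intros; ext; simp) (by intros; ext; simp [TensorProduct.smul_tmul'])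
    (by intros; ext; simp [TensorProduct.tmul_add]) (by intros; ext; simp)
  right_mul z a b := by
    induction z with
    | zero => simp
    | add x y hx hy => simp [hx, hy]
    | tmul x y => simp [right_mul]
  ip_right z w a := by
    induction z with
    | zero => simp
    | add x y hx hy => simp [hx, hy, add_mul]
    | tmul x y =>
      induction w with
      | zero => simp
      | add a b ha hb => simp [ha, hb, add_mul]
      | tmul x' y' =>
        simp only [tensorIp, TensorProduct.lift.tmul, LinearMap.mk₂'ₛₗ_apply, LinearMap.mk₂_apply,
          LinearMap.comp_apply, TensorProduct.mk_apply]
        rw [← star_star (ip x x'), ← ip_left, ← ip_left, ip_right]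
  left :=
    { toFun := fun a => TensorProduct.map (left a) LinearMap.id
      map_smul' := by intros; simp [TensorProduct.map_smul_left]
      map_zero' := by simp
      map_add' := by intros; simp [TensorProduct.map_add_left]
      map_mul' := by intros; rw [map_mul, ← TensorProduct.map_mul]; rfl }
  ip_left a z w := by
    induction z with
    | zero => simp
    | add x y hx hy => simp_all
    | tmul x y =>
      induction w with
      | zero => simp
      | add a b ha hb => simp_all
      | tmul x' y' => simp [tensorIp, ip_left]

end Tensor



section Completion
open UniformSpace.Completion

section Ext
variable {E₁ E₂ : Type*} [SeminormedAddCommGroup E₁] [NormedSpace ℂ E₁]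
  [SeminormedAddCommGroup E₂] [NormedSpace ℂ E₂] {σ : ℂ →+* ℂ}

/-- Extension of a bounded (semi)linear map to the completion. -/
def extendCompl {G : Type*} [AddCommGroup G] [UniformSpace G] [IsUniformAddGroup G] [T0Space G]
    [Module ℂ G] [ContinuousConstSMul ℂ G] [CompleteSpace G] (f : E₁ →SL[σ] G) :
    UniformSpace.Completion E₁ →SL[σ] G :=
  f.extend (toComplL : E₁ →L[ℂ] UniformSpace.Completion E₁)

@[simp] theorem extendCompl_coe {G : Type*} [AddCommGroup G] [UniformSpace G]
    [IsUniformAddGroup G] [T0Space G]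
    [Module ℂ G] [ContinuousConstSMul ℂ G] [CompleteSpace G] (f : E₁ →SL[σ] G) (x : E₁) :
    extendCompl f (x : UniformSpace.Completion E₁) = f x :=
  ContinuousLinearMap.extend_eq (e := (toComplL : E₁ →L[ℂ] UniformSpace.Completion E₁))
    f denseRange_coe (isUniformInducing_coe _) x

variable {G : Type*} [NormedAddCommGroup G] [NormedSpace ℂ G] [CompleteSpace G] [RingHomIsometric σ]

/-- Extension of a bounded (sesqui)bilinear map to the completions. -/
def extendCompl₂ (B : E₁ →SL[σ] E₂ →L[ℂ] G) :
    UniformSpace.Completion E₁ →SL[σ] UniformSpace.Completion E₂ →L[ℂ] G :=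
  let B' : UniformSpace.Completion E₁ →SL[σ] E₂ →L[ℂ] G := extendCompl (G := E₂ →L[ℂ] G) B
  let B'' : UniformSpace.Completion E₂ →L[ℂ] UniformSpace.Completion E₁ →SL[σ] G :=
    extendCompl B'.flip
  B''.flip

@[simp] theorem extendCompl₂_coe (B : E₁ →SL[σ] E₂ →L[ℂ] G) (x : E₁) (y : E₂) :
    extendCompl₂ B (x : UniformSpace.Completion E₁) (y : UniformSpace.Completion E₂) = B x y := by
  simp [extendCompl₂]

end Ext

end Completion

end PreHilbertBimodule

open PreHilbertBimodule UniformSpace.Completion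

variable (A : Type*) [NonUnitalCStarAlgebra A] [PartialOrder A] [StarOrderedRing A]
 (E : Type*) [AddCommGroup E] [Module ℂ E] [PreHilbertBimodule A E]

/-- The completion of `E`, after dividing out the vectors `x` with `⟨x, x⟩ = 0`. -/
abbrev HilbertCompletion : Type _ := UniformSpace.Completion (Semi A E)

namespace HilbertCompletion
variable {E}

/-- The class of `x : E` in the completion. -/
def of : E →ₗ[ℂ] HilbertCompletion A E where
  toFun x := toCompl (α := Semi A E) x
  map_add' x y := UniformSpace.Completion.coe_add (α := Semi A E) x y
  map_smul' c x := UniformSpace.Completion.coe_smul (X := Semi A E) c x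

variable (E)
/-- The extended inner product. -/
def ipL : HilbertCompletion A E →L⋆[ℂ] HilbertCompletion A E →L[ℂ] A :=
  extendCompl₂ (LinearMap.mkContinuous₂ (ip (A := A) (E := Semi A E)) 1
    (fun x y => by simpa using Semi.norm_ip_le x y))

/-- The extended right action. -/
def rightL : HilbertCompletion A E →L[ℂ] A →L[ℂ] HilbertCompletion A E :=
  extendCompl (((toComplL (𝕜 := ℂ) (E := Semi A E)).postcomp A).comp
    (LinearMap.mkContinuous₂ (right (A := A) (E := Semi A E)) 1
    (fun x y => by simpa using Semi.norm_right_le x y)))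

/-- The extended left action. -/
def leftL (a : A) : HilbertCompletion A E →L[ℂ] HilbertCompletion A E :=
  extendCompl ((toComplL (𝕜 := ℂ) (E := Semi A E)).comp
    (LinearMap.mkContinuous (left (A := A) (E := Semi A E) a) ‖a‖ (Semi.norm_left_le a)))

variable {A E}

@[simp] theorem ipL_coe (x y : Semi A E) :
  ipL A E x y = ip (A := A) x y := by simp [ipL]

@[simp] theorem rightL_coe (x : Semi A E) (a : A) :
  rightL A E x a = ((right x a : Semi A E) : HilbertCompletion A E) := by
    simp [rightL]

@[simp] theorem leftL_coe (x : Semi A E) (a : A) :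
  leftL A E a x = ((left a x : Semi A E) : HilbertCompletion A E) := by simp [leftL]

theorem leftL_smul (c : ℂ) (a : A) (x : HilbertCompletion A E) :
    leftL A E (c • a) x = c • leftL A E a x := by
  induction x using UniformSpace.Completion.induction_on with
  | hp =>
    exact isClosed_eq (leftL A E (c • a)).continuous ((leftL A E a).continuous.const_smul c)
  | ih x =>
    simp only [leftL_coe, map_smul, LinearMap.smul_apply]
    exact UniformSpace.Completion.coe_smul _ _

theorem leftL_zero (x : HilbertCompletion A E) : leftL A E (0 : A) x = 0 := by
  simpa using leftL_smul (0 : ℂ) (0 : A) x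

theorem leftL_add (a b : A) (x : HilbertCompletion A E) :
    leftL A E (a + b) x = leftL A E a x + leftL A E b x := by
  induction x using UniformSpace.Completion.induction_on with
  | hp => apply isClosed_eq <;> fun_prop
  | ih x =>
    simp only [leftL_coe, map_add, LinearMap.add_apply]
    exact UniformSpace.Completion.coe_add _ _

theorem leftL_mul (a b : A) (x : HilbertCompletion A E) :
    leftL A E (a * b) x = leftL A E a (leftL A E b x) := by
  induction x using UniformSpace.Completion.induction_on with
  | hp => apply isClosed_eq <;> fun_prop
  | ih x => simp

theorem norm_sq_eq (x : HilbertCompletion A E) : ‖x‖ ^ 2 = ‖ipL A E x x‖ := by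
  induction x using UniformSpace.Completion.induction_on with
  | hp => apply isClosed_eq <;> fun_prop
  | ih x => rw [ipL_coe, norm_coe, Semi.norm_sq]

end HilbertCompletion

open HilbertCompletion

/-- The completion is a Hilbert bimodule. -/
instance : HilbertBimodule A (HilbertCompletion A E) where
  ip := (ContinuousLinearMap.coeLM ℂ).comp (ipL A E).toLinearMap
  star_ip x y := by
    change star (ipL A E x y) = ipL A E y x
    induction x, y using UniformSpace.Completion.induction_on₂ with
    | hp => apply isClosed_eq <;> fun_prop
    | ih x y => simp [star_ip]
  ip_self_nonneg x := by
    change 0 ≤ ipL A E x x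
    induction x using UniformSpace.Completion.induction_on with
    | hp => apply isClosed_le <;> fun_prop
    | ih x => simpa using ip_self_nonneg _
  right := (ContinuousLinearMap.coeLM ℂ).comp (rightL A E).toLinearMap
  right_mul x a b := by
    change rightL A E x (a * b) = rightL A E (rightL A E x a) b
    induction x using UniformSpace.Completion.induction_on with
    | hp => apply isClosed_eq <;> fun_prop
    | ih x => simp [right_mul]
  ip_right x y a := by
    change ipL A E x (rightL A E y a) = ipL A E x y * a
    induction x, y using UniformSpace.Completion.induction_on₂ with
    | hp => apply isClosed_eq <;> fun_prop
    | ih x y => simp [ip_right]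
  left :=
    { toFun := fun a => (leftL A E a).toLinearMap
      map_smul' := fun c a => LinearMap.ext (leftL_smul c a)
      map_zero' := LinearMap.ext leftL_zero
      map_add' := fun a b => LinearMap.ext (leftL_add a b)
      map_mul' := fun a b => LinearMap.ext (leftL_mul a b) }
  ip_left a x y := by
    change ipL A E (leftL A E a x) y = ipL A E x (leftL A E (star a) y)
    induction x, y using UniformSpace.Completion.induction_on₂ with
    | hp => apply isClosed_eq <;> fun_prop
    | ih x y => rw [leftL_coe, leftL_coe, ipL_coe, ipL_coe, ip_left]
  norm_sq := norm_sq_eq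
  complete := inferInstance


theorem HilbertCompletion.of_eq (x : E) : (of A x : HilbertCompletion A E) =
   UniformSpace.Completion.coe' (α := Semi A E) x := rfl

theorem HilbertCompletion.ip_of (x y : E) :
    ip (A := A) (of A x : HilbertCompletion A E) (of A y) = ip x y :=
  ipL_coe (A := A) (E := E) x y

theorem HilbertCompletion.right_of (x : E) (a : A) :
    right (of A x : HilbertCompletion A E) a = of A (right x a) :=
  rightL_coe (A := A) (E := E) x a

theorem HilbertCompletion.left_of (x : E) (a : A) :
    left a (of A x : HilbertCompletion A E) = of A (left a x) :=
  leftL_coe (A := A) (E := E) x a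

section Bimodules
variable (X Y : Type*) [NormedAddCommGroup X] [NormedSpace ℂ X] [HilbertBimodule A X]
  [NormedAddCommGroup Y] [NormedSpace ℂ Y] [HilbertBimodule A Y]

/-- An isomorphism of Hilbert bimodules over `A`. -/
structure HilbertBimoduleIso where
  toLinearEquiv : X ≃ₗ[ℂ] Y
  ip_map : ∀ x y, ip (A := A) (toLinearEquiv x) (toLinearEquiv y) = ip x y
  right_map : ∀ x (a : A), toLinearEquiv (right x a) = right (toLinearEquiv x) a
  left_map : ∀ (a : A) x, toLinearEquiv (left a x) = left a (toLinearEquiv x)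

instance : CoeFun (HilbertBimoduleIso A X Y) (fun _ => X → Y) := ⟨fun U => U.toLinearEquiv⟩

/-- `X` is essential: `X` is the closed linear span of the vectors `a · x`. -/
def HilbertBimodule.IsEssential : Prop :=
  (Submodule.span ℂ {z : X | ∃ (a : A) (x : X), z = left a x}).topologicalClosure = ⊤

/-- The internal tensor product `X ⊗_A Y` of Hilbert bimodules: the completion of the algebraic
tensor product in `⟨x ⊗ y, x' ⊗ y'⟩ = ⟨y, ⟨x, x'⟩ · y'⟩`. The differences
`(x · a) ⊗ y - x ⊗ (a · y)` have length zero for this form, so they vanish in the completion. -/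
abbrev InternalTensor : Type _ := HilbertCompletion A (X ⊗[ℂ] Y)

variable {X Y} in
/-- The elementary tensor `x ⊗_A y`. -/
def InternalTensor.mk (x : X) (y : Y) : InternalTensor A X Y := of A (x ⊗ₜ[ℂ] y)

/-- `A` as a Hilbert bimodule over itself: `⟨x, y⟩ = x⋆ y`, with multiplication on both sides. -/
instance HilbertBimodule.self : HilbertBimodule A A where
  ip := LinearMap.mk₂'ₛₗ (starRingEnd ℂ) (RingHom.id ℂ) (fun x y => star x * y)
    (by intros; simp [add_mul]) (by intros; simp; exact smul_mul_assoc _ _ _) (by intros; simp [mul_add]) (by intros; exact mul_smul_comm _ _ _)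
  star_ip := by intros; simp
  ip_self_nonneg x := star_mul_self_nonneg x
  right := LinearMap.mul ℂ A
  right_mul := by intros; simp [mul_assoc]
  ip_right := by intros; simp [mul_assoc]
  left :=
    { toFun := fun a => LinearMap.mul ℂ A a
      map_smul' := by intros; simp
      map_zero' := by simp
      map_add' := by intros; simp
      map_mul' := by intros; ext; simp [mul_assoc] }
  ip_left := by intros; simp [mul_assoc]
  norm_sq x := by
    change _ = ‖star x * x‖
    rw [CStarRing.norm_star_mul_self, sq]
  complete := inferInstance
end Bimodules

variable {A}

/-- The disjoint union `⊔ X s` of a family of Hilbert bimodules over `A`, with the multiplication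
`mul` and the identification `ι` of `A` with `X 0`, is a product system over `S`: `mul` is
associative, the projection `(s, x) ↦ s` is a homomorphism, multiplication
`X s × X t → X (s + t)` extends to an isomorphism `X s ⊗_A X t ≅ X (s + t)` of Hilbert bimodules
for `s, t ≠ 0`, and multiplication by elements of `X 0 = A` is given by the module actions. -/
structure IsProductSystem {S : Type*} [AddMonoid S] {X : S → Type*}
    [∀ s, NormedAddCommGroup (X s)] [∀ s, NormedSpace ℂ (X s)] [∀ s, HilbertBimodule A (X s)]
    (mul : (Σ s, X s) → (Σ s, X s) → (Σ s, X s)) (ι : HilbertBimoduleIso A A (X 0)) : Prop where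
  assoc : ∀ x y z, mul (mul x y) z = mul x (mul y z)
  fst_mul : ∀ x y, (mul x y).1 = x.1 + y.1
  tensor : ∀ s t, s ≠ 0 → t ≠ 0 →
    ∃ U : HilbertBimoduleIso A (InternalTensor A (X s) (X t)) (X (s + t)),
      ∀ (x : X s) (y : X t), mul ⟨s, x⟩ ⟨t, y⟩ = ⟨s + t, U (InternalTensor.mk A x y)⟩
  zero_mul : ∀ (a : A) s (x : X s), mul ⟨0, ι a⟩ ⟨s, x⟩ = ⟨s, left a x⟩
  mul_zero : ∀ (a : A) s (x : X s), mul ⟨s, x⟩ ⟨0, ι a⟩ = ⟨s, right x a⟩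

variable (A) in
/-- A system `(A, S, α, L)`: an action `α` of the abelian monoid `S` on the C⋆-algebra `A` by
extendible endomorphisms and an action `L` of `S` by transfer operators for `α`.
`αbar s` is the extension of `α s` to the multiplier algebra `M(A)`; its value at `1` is the strict
limit of `α s u` along some approximate unit. `Lbar s` is a continuous linear extension of `L s` to
`M(A)`. For `u : M(A)` and `a : A`, `u.fst a` is `u a` and `u.snd a` is `a u`. -/
structure TransferSystem (S : Type*) [AddCommMonoid S] where
  α : S → A →⋆ₙₐ[ℂ] A
  α_zero : ∀ a, α 0 a = a
  α_add : ∀ s t a, α (s + t) a = α s (α t a)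
  αbar : S → 𝓜(ℂ, A) →⋆ₙₐ[ℂ] 𝓜(ℂ, A)
  αbar_coe : ∀ s (a : A), αbar s (a : 𝓜(ℂ, A)) = (α s a : 𝓜(ℂ, A))
  αbar_one : ∀ s, ∃ l : Filter A, l.IsApproximateUnit ∧ ∀ a : A,
    Tendsto (fun u => α s u * a) l (𝓝 ((αbar s 1).fst a)) ∧
    Tendsto (fun u => a * α s u) l (𝓝 ((αbar s 1).snd a))
  L : S → A →L[ℂ] A
  L_zero : ∀ a, L 0 a = a
  L_add : ∀ s t a, L (s + t) a = L s (L t a)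
  L_nonneg : ∀ s a, 0 ≤ a → 0 ≤ L s a
  Lbar : S → 𝓜(ℂ, A) →L[ℂ] 𝓜(ℂ, A)
  Lbar_coe : ∀ s (a : A), Lbar s (a : 𝓜(ℂ, A)) = (L s a : 𝓜(ℂ, A))
  transfer : ∀ s (a : A) (u : 𝓜(ℂ, A)), L s (u.snd (α s a)) = (Lbar s u).snd a

namespace TransferSystem
variable {S : Type*} [AddCommMonoid S] (D : TransferSystem A S)

/-- The map `a ↦ a ᾱ_s(1)`. -/
def mulOne (s : S) : A →L[ℂ] A := (D.αbar s 1).snd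

/-- The subspace `A_s = A ᾱ_s(1)` of `A`. -/
def sub (s : S) : Submodule ℂ A := LinearMap.range (D.mulOne s).toLinearMap

theorem L_star (s : S) (a : A) : D.L s (star a) = star (D.L s a) := by
  let f : A →ₚ[ℂ] A := PositiveLinearMap.mk₀ (D.L s).toLinearMap (D.L_nonneg s)
  exact map_star f a

theorem L_alpha_mul (s : S) (a u : A) : D.L s (D.α s a * u) = a * D.L s u := by
  have := D.transfer s a u
  rwa [D.Lbar_coe] at this

theorem L_mul_alpha (s : S) (a u : A) : D.L s (u * D.α s a) = D.L s u * a := by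
  rw [← star_star (D.L s _), ← L_star, star_mul, ← map_star (D.α s), L_alpha_mul, star_mul, L_star,
    star_star, star_star]

theorem ext_mul (x y : A) (h : ∀ c, x * c = y * c) : x = y := by
  have := h (star (x - y))
  rwa [← sub_eq_zero, ← sub_mul, CStarRing.mul_star_self_eq_zero_iff, sub_eq_zero] at this

theorem mulOne_mul (s : S) (a b : A) : D.mulOne s (a * b) = a * D.mulOne s b := by
  have h : ∀ m : 𝓜(ℂ, A), m.snd (a * b) = a * m.snd b := by
    intro m
    refine ext_mul _ _ fun c => ?_
    rw [m.central, mul_assoc, mul_assoc, m.central]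
  exact h _

theorem mulOne_alpha (s : S) (a : A) : D.mulOne s (D.α s a) = D.α s a := by
  have h : D.αbar s (a : 𝓜(ℂ, A)) * D.αbar s 1 = D.αbar s (a : 𝓜(ℂ, A)) := by
    rw [← map_mul, mul_one]
  rw [D.αbar_coe] at h
  refine star_injective (ext_mul _ _ fun c => star_injective ?_)
  rw [star_mul, star_mul, star_star, star_star, ← mulOne_mul]
  exact congrArg (fun m : 𝓜(ℂ, A) => m.snd (star c)) h

theorem mulOne_mulOne (s : S) (a : A) : D.mulOne s (D.mulOne s a) = D.mulOne s a := by
  have h : D.αbar s 1 * D.αbar s 1 = D.αbar s 1 := by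
    rw [← map_mul, mul_one]
  exact congrArg (fun m : 𝓜(ℂ, A) => m.snd a) h

theorem mem_sub (s : S) (x : A) : x ∈ D.sub s ↔ D.mulOne s x = x :=
  ⟨by rintro ⟨y, rfl⟩; exact D.mulOne_mulOne s y, fun h => ⟨x, h⟩⟩

/-- The element `a ᾱ_s(1)` of `A_s`. -/
def elt (s : S) (a : A) : D.sub s := ⟨D.mulOne s a, a, rfl⟩

/-- The form `⟨x, y⟩ = L_s(x⋆ y)` and the actions `x · a = x α_s(a)`, `a · x = a x` on `A_s`. -/
instance (s : S) : PreHilbertBimodule A (D.sub s) where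
  ip := LinearMap.mk₂'ₛₗ (starRingEnd ℂ) (RingHom.id ℂ) (fun x y => D.L s (star (x : A) * y))
    (by intros; simp [add_mul]) (by intros; simp only [Submodule.coe_smul, star_smul, smul_mul_assoc, map_smul]; rfl) (by intros; simp [mul_add]) (by intros; simp only [Submodule.coe_smul, mul_smul_comm, map_smul]; rfl)
  star_ip := by intros; simp [← L_star]
  ip_self_nonneg x := D.L_nonneg s _ (star_mul_self_nonneg _)
  right := LinearMap.mk₂ ℂ (fun x a => ⟨x * D.α s a, by rw [mem_sub, mulOne_mul, mulOne_alpha]⟩)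
    (by intros; ext; simp [add_mul]) (by intros; ext; simp [smul_mul_assoc]) (by intros; ext; simp [mul_add])
    (by intros; ext; simp [mul_smul_comm])
  right_mul := by intros; ext; simp [mul_assoc]
  ip_right := by intros; simp [← mul_assoc, L_mul_alpha]
  left :=
    { toFun := fun a =>
       { toFun := fun x => ⟨a * x, by rw [mem_sub, mulOne_mul, (D.mem_sub s x).1 x.2]⟩
         map_add' := by intros; ext; simp [mul_add]
         map_smul' := by intros; ext; simp [mul_smul_comm] }
      map_smul' := by intros; ext; simp [smul_mul_assoc]
      map_zero' := by ext; simp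
      map_add' := by intros; ext; simp [add_mul]
      map_mul' := by intros; ext; simp [mul_assoc] }
  ip_left := by intros; simp [mul_assoc]

/-- The completion `M_s` of `A_s`. -/
abbrev Fibre (s : S) : Type _ := HilbertCompletion A (D.sub s)

theorem mul_alpha_mem (s t : S) (x : D.sub s) (y : D.sub t) :
    (x : A) * D.α s y ∈ D.sub (s + t) := by
  rw [mem_sub, mulOne_mul]
  congr 1
  obtain ⟨l, hl, h⟩ := D.αbar_one t
  have := hl.neBot
  obtain ⟨y, b, rfl⟩ := y
  have h1 : Tendsto (fun u => D.α s (b * D.α t u)) l (𝓝 (D.α s (D.mulOne t b))) :=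
    ((map_continuous (D.α s)).tendsto _).comp (h b).2
  have h2 := ((D.mulOne (s + t)).continuous.tendsto _).comp h1
  refine tendsto_nhds_unique (h2.congr fun u => ?_) h1
  simp only [Function.comp_apply, map_mul, mulOne_mul, ← D.α_add, mulOne_alpha]

/-- The product `(x, y) ↦ x α_s(y)` from `A_s × A_t` to `A_{s+t}`. -/
def preMul (s t : S) : D.sub s →ₗ[ℂ] D.sub t →ₗ[ℂ] D.sub (s + t) :=
  LinearMap.mk₂ ℂ (fun x y => ⟨x * D.α s y, D.mul_alpha_mem s t x y⟩)
    (by intros; ext; simp [add_mul]) (by intros; ext; simp [smul_mul_assoc]) (by intros; ext; simp [mul_add])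
    (by intros; ext; simp [mul_smul_comm])

theorem preMul_bound (s t : S) (x : D.sub s) (y : D.sub t) :
    ‖ip (A := A) (D.preMul s t x y) (D.preMul s t x y)‖
      ≤ ‖ip (A := A) x x‖ * ‖ip (A := A) y y‖ := by
  have h1 : ip (A := A) (D.preMul s t x y) (D.preMul s t x y)
      = D.L t (star (y : A) * D.L s (star (x : A) * x) * y) := by
    change D.L (s + t) (star ((x : A) * D.α s y) * ((x : A) * D.α s y)) = _
    rw [add_comm, D.L_add, star_mul, ← map_star (D.α s), mul_assoc, L_alpha_mul, ← mul_assoc,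
      L_mul_alpha, mul_assoc]
  have h2 : star (y : A) * D.L s (star (x : A) * x) * y ≤
      ‖D.L s (star (x : A) * x)‖ • (star (y : A) * y) :=
    CStarAlgebra.star_left_conjugate_le_norm_smul
      (hb := .of_nonneg (D.L_nonneg s _ (star_mul_self_nonneg _)))
  have h3 : 0 ≤ star (y : A) * D.L s (star (x : A) * x) * y :=
    star_left_conjugate_nonneg (D.L_nonneg s _ (star_mul_self_nonneg _)) _
  have h4 := D.L_nonneg t _ (sub_nonneg.2 h2)
  rw [map_sub, sub_nonneg] at h4
  have h5 := CStarAlgebra.norm_le_norm_of_nonneg_of_le (D.L_nonneg t _ h3) h4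
  rw [h1]
  refine h5.trans_eq ?_
  rw [← Complex.coe_smul, map_smul, norm_smul, Complex.norm_real, norm_norm]
  rfl

/-- `preMul` as a map between the seminormed spaces. -/
def preMulSemi (s t : S) : Semi A (D.sub s) →ₗ[ℂ] Semi A (D.sub t) →ₗ[ℂ] Semi A (D.sub (s + t)) :=
  D.preMul s t

theorem preMulSemi_bound (s t : S) (x : Semi A (D.sub s)) (y : Semi A (D.sub t)) :
    ‖D.preMulSemi s t x y‖ ≤ 1 * ‖x‖ * ‖y‖ := by
  rw [one_mul]
  refine le_of_sq_le_sq ?_ (by positivity)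
  rw [mul_pow, Semi.norm_sq, Semi.norm_sq, Semi.norm_sq]
  exact D.preMul_bound s t x y

/-- The continuous extension of `preMul` to `M_s × M_t → M_{s+t}`. -/
def fibreMul (s t : S) : D.Fibre s →L[ℂ] D.Fibre t →L[ℂ] D.Fibre (s + t) :=
  extendCompl₂ (((toComplL (𝕜 := ℂ) (E := Semi A (D.sub (s + t)))).postcomp (Semi A (D.sub t))).comp
    (LinearMap.mkContinuous₂ (D.preMulSemi s t) 1 (D.preMulSemi_bound s t)))

theorem fibreMul_of (s t : S) (x : D.sub s) (y : D.sub t) :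
    D.fibreMul s t (of A x) (of A y) = of A (D.preMul s t x y) := by
  refine (extendCompl₂_coe _ _ _).trans ?_
  rfl

/-- The product on the disjoint union `X = ⊔ {s} × M_s`. -/
def mul (x y : Σ s, D.Fibre s) : Σ s, D.Fibre s := ⟨x.1 + y.1, D.fibreMul x.1 y.1 x.2 y.2⟩

/-- The class of `a ᾱ_s(1)` in `M_s`. -/
def cls (s : S) (a : A) : D.Fibre s := of A (D.elt s a)

theorem mulOne_mul_alpha (s : S) (a b : A) : D.mulOne s a * D.α s b = a * D.α s b := by
  have h : D.αbar s 1 * D.αbar s (b : 𝓜(ℂ, A)) = D.αbar s (b : 𝓜(ℂ, A)) := by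
    rw [← map_mul, one_mul]
  rw [D.αbar_coe] at h
  exact congrArg (fun m : 𝓜(ℂ, A) => m.snd a) h

/-- The product formula `(s, a ᾱ_s(1)) (t, b ᾱ_t(1)) = (s + t, a α_s(b ᾱ_t(1)))`. -/
theorem mul_cls (s t : S) (a b : A) :
    D.mul ⟨s, D.cls s a⟩ ⟨t, D.cls t b⟩ = ⟨s + t, of A ⟨a * D.α s (D.mulOne t b), by
      rw [← mulOne_mul_alpha]; exact D.mul_alpha_mem s t (D.elt s a) (D.elt t b)⟩⟩ := by
  simp only [mul, cls, fibreMul_of]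
  congr 2
  exact Subtype.ext (D.mulOne_mul_alpha s a _)

end TransferSystem

end

noncomputable section

open scoped MultiplierAlgebra TensorProduct Topology
open Filter PreHilbertBimodule HilbertCompletion

/-! Everything is computed in the subspaces `A_s` of `A` and carried to the completions by density
and continuity. The central identity is `preMul_ip`. Since `S` is abelian, L_{s+t} = L_t ∘ L_s, and
the transfer identity on both sides pulls α_s(y)⋆ and α_s(y') out of L_s: L_{s+t}((x α_s(y))⋆ x'
α_s(y')) = L_t(y⋆ L_s(x⋆ x') y') = ⟨y, ⟨x, x'⟩ · y'⟩_t. This is exactly the inner product on X_s ⊗_A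
X_t, so multiplication induces an isometry on the internal tensor product.

Its range is dense by extendibility (`dense_preMul`): a ᾱ_{s+t}(1) is the limit of a α_{s+t}(u) = (a
ᾱ_s(1)) α_s(α_t(u)) along an approximate unit. This limit in the norm of `A` is also one in the
fibre, because L_s is bounded (`continuous_of`). An isometry from a complete space with dense range
is onto (`HilbertBimoduleIso.ofDenseRange`).

Associativity reduces to α_{s+t} = α_s ∘ α_t. The fibre over 0 is `A` because α_0 and L_0 are
identities and ᾱ_0(1) acts as 1 on `A`. Fibres are essential because u x → x along an approximate
unit. -/

theorem HilbertBimodule.norm_map_of_ip_map {A X Y : Type*} [NonUnitalCStarAlgebra A] [PartialOrder A]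
    [NormedAddCommGroup X] [NormedSpace ℂ X] [HilbertBimodule A X]
    [NormedAddCommGroup Y] [NormedSpace ℂ Y] [HilbertBimodule A Y]
    (f : X →ₗ[ℂ] Y)
    (hip : ∀ x, ip (A := A) (f x) (f x) = ip x x) (x : X) : ‖f x‖ = ‖x‖ := by
  rw [← sq_eq_sq₀ (norm_nonneg _) (norm_nonneg _), HilbertBimodule.norm_sq (A := A),
    HilbertBimodule.norm_sq (A := A), hip]

/-! ### Isomorphisms of Hilbert bimodules and extension to completions -/

section Bimodules

variable {A : Type*} [NonUnitalCStarAlgebra A] [PartialOrder A] [StarOrderedRing A]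

namespace HilbertCompletion

variable {E : Type*} [AddCommGroup E] [Module ℂ E] [PreHilbertBimodule A E]

theorem induction_of {p : HilbertCompletion A E → Prop} (x : HilbertCompletion A E)
    (hp : IsClosed {x | p x}) (ih : ∀ x : E, p (of A x)) : p x :=
  UniformSpace.Completion.induction_on x hp ih

variable (A) in
theorem denseRange_of : DenseRange (of A : E → HilbertCompletion A E) :=
  UniformSpace.Completion.denseRange_coe (α := Semi A E)

/-- The structure maps of a Hilbert bimodule are merely algebraic linear maps. This equation and the
next two expose the bounded maps behind them, which is how the closedness conditions in density
arguments are verified. -/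
theorem ip_eq (x y : HilbertCompletion A E) : ip (A := A) x y = ipL A E x y := rfl

theorem right_eq (x : HilbertCompletion A E) (a : A) : right x a = rightL A E x a := rfl

theorem left_eq (a : A) (x : HilbertCompletion A E) : left a x = leftL A E a x := rfl

end HilbertCompletion

section Iso

variable {X Y : Type*} [NormedAddCommGroup X] [NormedSpace ℂ X] [HilbertBimodule A X]
  [NormedAddCommGroup Y] [NormedSpace ℂ Y] [HilbertBimodule A Y]

/-- An inner product preserving bimodule map with dense range is an isomorphism. -/
def HilbertBimoduleIso.ofDenseRange (f : X →ₗ[ℂ] Y)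
    (hip : ∀ x y, ip (A := A) (f x) (f y) = ip x y)
    (hr : ∀ x (a : A), f (right x a) = right (f x) a)
    (hl : ∀ (a : A) x, f (left a x) = left a (f x))
    (hd : DenseRange f) : HilbertBimoduleIso A X Y where
  toLinearEquiv := LinearEquiv.ofBijective f <| by
    have hi : Isometry f := AddMonoidHomClass.isometry_of_norm f
      (HilbertBimodule.norm_map_of_ip_map (A := A) f fun x => hip x x)
    have := HilbertBimodule.complete (A := A) (E := X)
    refine ⟨hi.injective, fun y => ?_⟩
    -- The isometric image of a complete space is closed, so a dense range is everything.
    have := hi.isClosedEmbedding.isClosed_range.closure_eq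
    rw [hd.closure_range] at this
    exact this.subset (Set.mem_univ y)
  ip_map := hip
  right_map := hr
  left_map := hl

end Iso

section Lift

variable {E : Type*} [AddCommGroup E] [Module ℂ E] [PreHilbertBimodule A E]
  {Y : Type*} [NormedAddCommGroup Y] [NormedSpace ℂ Y] [HilbertBimodule A Y]

/-- The extension to the completion of an inner product preserving map. -/
def HilbertCompletion.lift (f : E →ₗ[ℂ] Y) (hip : ∀ x y, ip (A := A) (f x) (f y) = ip x y) :
    HilbertCompletion A E →L[ℂ] Y :=
  haveI := HilbertBimodule.complete (A := A) (E := Y)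
  extendCompl (LinearMap.mkContinuous (E := Semi A E) (show Semi A E →ₗ[ℂ] Y from f) 1 fun x => by
    rw [one_mul]
    refine le_of_sq_le_sq ?_ (norm_nonneg _)
    rw [Semi.norm_sq, HilbertBimodule.norm_sq (A := A)]
    exact (congrArg norm (hip x x)).le)

theorem HilbertCompletion.lift_of (f : E →ₗ[ℂ] Y)
    (hip : ∀ x y, ip (A := A) (f x) (f y) = ip x y) (x : E) :
    HilbertCompletion.lift f hip (of A x) = f x :=
  haveI := HilbertBimodule.complete (A := A) (E := Y)
  extendCompl_coe _ _

/-- An inner product preserving bimodule map with dense range extends to an isomorphism from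
the completion. -/
theorem HilbertCompletion.exists_iso {F : Type*} [AddCommGroup F] [Module ℂ F]
    [PreHilbertBimodule A F] (f : E →ₗ[ℂ] HilbertCompletion A F)
    (hip : ∀ x y, ip (A := A) (f x) (f y) = ip x y)
    (hr : ∀ x (a : A), f (right x a) = right (f x) a)
    (hl : ∀ (a : A) x, f (left a x) = left a (f x))
    (hd : DenseRange f) :
    ∃ U : HilbertBimoduleIso A (HilbertCompletion A E) (HilbertCompletion A F),
      ∀ x, U (of A x) = f x := by
  refine ⟨HilbertBimoduleIso.ofDenseRange (HilbertCompletion.lift f hip).toLinearMap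
    (fun x y => ?_) (fun x a => ?_) (fun a x => ?_) ?_, HilbertCompletion.lift_of f hip⟩
  · simp only [ContinuousLinearMap.coe_coe]
    induction x using induction_of with
    | hp => simp only [ip_eq]; apply isClosed_eq <;> fun_prop
    | ih x =>
      induction y using induction_of with
      | hp => simp only [ip_eq]; apply isClosed_eq <;> fun_prop
      | ih y => rw [lift_of, lift_of, ip_of, hip]
  · simp only [ContinuousLinearMap.coe_coe]
    induction x using induction_of with
    | hp => simp only [right_eq]; apply isClosed_eq <;> fun_prop
    | ih x => rw [right_of, lift_of, lift_of, hr]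
  · simp only [ContinuousLinearMap.coe_coe]
    induction x using induction_of with
    | hp => simp only [left_eq]; apply isClosed_eq <;> fun_prop
    | ih x => rw [left_of, lift_of, lift_of, hl]
  · refine hd.mono ?_
    rintro _ ⟨x, rfl⟩
    exact ⟨of A x, lift_of f hip x⟩

end Lift

end Bimodules

/-! ### The subspaces `A_s` and their products -/

namespace TransferSystem

variable {A : Type*} [NonUnitalCStarAlgebra A] [PartialOrder A]
  {S : Type*} [AddCommMonoid S] (D : TransferSystem A S)

theorem exists_approximateUnit (s : S) :
    ∃ l : Filter A, l.IsApproximateUnit ∧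
      ∀ a, Tendsto (fun u => a * D.α s u) l (𝓝 (D.mulOne s a)) :=
  let ⟨l, hl, h⟩ := D.αbar_one s
  ⟨l, hl, fun a => (h a).2⟩

/-- Because α_0 = id, the net a α_0(u) = a u tends both to a ᾱ_0(1) and to a. The strict limit is
needed here: `αbar 0` is not given as the identity of M(A). -/
theorem mulOne_zero (a : A) : D.mulOne 0 a = a := by
  obtain ⟨l, hl, h⟩ := D.exists_approximateUnit 0
  have := hl.neBot
  refine tendsto_nhds_unique (h a) ?_
  simpa only [D.α_zero] using hl.tendsto_mul_left a

theorem coe_elt (s : S) (a : A) : (D.elt s a : A) = D.mulOne s a := rfl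

variable [StarOrderedRing A]

/-- The fibre seminorm is ‖L_s(x⋆x)‖^(1/2), so boundedness of L_s makes it weaker than the norm of
`A`. Limits computed in `A` thus survive in `M_s`. -/
theorem norm_of_sq_le (s : S) (x : D.sub s) :
    ‖(of A x : D.Fibre s)‖ ^ 2 ≤ ‖D.L s‖ * ‖(x : A)‖ ^ 2 := by
  rw [HilbertBimodule.norm_sq (A := A), ip_of]
  refine ((D.L s).le_opNorm _).trans_eq ?_
  rw [CStarRing.norm_star_mul_self, sq]

theorem continuous_of (s : S) : Continuous (of A : D.sub s → D.Fibre s) := by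
  refine AddMonoidHomClass.continuous_of_bound (of A : D.sub s →ₗ[ℂ] D.Fibre s) √‖D.L s‖
    fun x => ?_
  refine le_of_sq_le_sq ?_ (by positivity)
  rw [mul_pow, Real.sq_sqrt (norm_nonneg _)]
  exact D.norm_of_sq_le s x

theorem coe_left (s : S) (a : A) (x : D.sub s) : ((left a x : D.sub s) : A) = a * x := rfl

theorem coe_right (s : S) (x : D.sub s) (a : A) : ((right x a : D.sub s) : A) = x * D.α s a := rfl

theorem ip_sub (s : S) (x y : D.sub s) : ip (A := A) x y = D.L s (star (x : A) * y) := rfl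

theorem coe_preMul (s t : S) (x : D.sub s) (y : D.sub t) :
    (D.preMul s t x y : A) = x * D.α s y := rfl

/-- The identity that makes multiplication isometric for the internal tensor product; it rests on
the transfer identity and its adjoint form. -/
theorem preMul_ip (s t : S) (x x' : D.sub s) (y y' : D.sub t) :
    ip (A := A) (D.preMul s t x y) (D.preMul s t x' y') = ip y (left (ip (A := A) x x') y') := by
  simp only [ip_sub, coe_preMul, coe_left]
  -- Commutativity of `S` lets L_s act before L_t, so that L_s meets the factors α_s(y⋆) and
  -- α_s(y').
  rw [add_comm, D.L_add, star_mul, ← map_star (D.α s), mul_assoc, L_alpha_mul, ← mul_assoc (star _),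
    L_mul_alpha]

theorem preMul_right (s t : S) (x : D.sub s) (y : D.sub t) (a : A) :
    D.preMul s t x (right y a) = right (D.preMul s t x y) a := by
  ext; simp only [coe_preMul, coe_right, map_mul, D.α_add, mul_assoc]

theorem preMul_left (s t : S) (a : A) (x : D.sub s) (y : D.sub t) :
    D.preMul s t (left a x) y = left a (D.preMul s t x y) := by
  ext; simp only [coe_preMul, coe_left, mul_assoc]

/-! ### Multiplication on the completed fibres -/

theorem fibreMul_ip (s t : S) (x x' : D.Fibre s) (y y' : D.Fibre t) :
    ip (A := A) (D.fibreMul s t x y) (D.fibreMul s t x' y')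
      = ip y (left (ip (A := A) x x') y') := by
  rw [← star_star (ip x x'), ← ip_left]
  induction y using induction_of with
  | hp =>
    simp only [ip_eq, left_eq]
    apply isClosed_eq <;> fun_prop
  | ih y =>
  rw [ip_left, star_star]
  induction y' using induction_of with
  | hp =>
    simp only [ip_eq, left_eq]
    apply isClosed_eq <;> fun_prop
  | ih y' =>
  -- Continuity of the left action in the algebra variable: for y' in `A_t` it follows from that of
  -- a ↦ a y' in `A`. For this reason y and y' are reduced to `A_t` before x and x' are treated.
  have hc : Continuous fun a : A =>
      ip (A := A) (of A y : D.Fibre t) (left a (of A y' : D.Fibre t)) := by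
    refine (ipL A (D.sub t) (of A y)).continuous.comp ?_
    simp only [left_of]
    exact (D.continuous_of t).comp <|
      Continuous.subtype_mk (f := fun a : A => a * (y' : A)) (by fun_prop) _
  induction x using induction_of with
  | hp =>
    refine isClosed_eq ?_ (hc.comp ?_)
    · simp only [ip_eq]; fun_prop
    · simp only [ip_eq]; fun_prop
  | ih x =>
  induction x' using induction_of with
  | hp =>
    refine isClosed_eq ?_ (hc.comp ?_)
    · simp only [ip_eq]; fun_prop
    · exact (ipL A (D.sub s) (of A x)).continuous
  | ih x' => simp only [fibreMul_of, ip_of, left_of, preMul_ip]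

theorem fibreMul_right (s t : S) (x : D.Fibre s) (y : D.Fibre t) (a : A) :
    D.fibreMul s t x (right y a) = right (D.fibreMul s t x y) a := by
  induction x using induction_of with
  | hp => simp only [right_eq]; apply isClosed_eq <;> fun_prop
  | ih x =>
  induction y using induction_of with
  | hp => simp only [right_eq]; apply isClosed_eq <;> fun_prop
  | ih y => simp only [right_of, fibreMul_of, preMul_right]

theorem fibreMul_left (s t : S) (a : A) (x : D.Fibre s) (y : D.Fibre t) :
    D.fibreMul s t (left a x) y = left a (D.fibreMul s t x y) := by
  induction x using induction_of with
  | hp => simp only [left_eq]; apply isClosed_eq <;> fun_prop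
  | ih x =>
  induction y using induction_of with
  | hp => simp only [left_eq]; apply isClosed_eq <;> fun_prop
  | ih y => simp only [left_of, fibreMul_of, preMul_left]

/-! ### Density of products and the tensor product isomorphism -/

/-- Products `x α_s(y)` with `x ∈ A_s`, `y ∈ A_t` are dense in `M_{s+t}`. -/
theorem dense_preMul (s t : S) :
    Dense {z : D.Fibre (s + t) | ∃ x y, z = of A (D.preMul s t x y)} := by
  rw [← dense_closure]
  refine (denseRange_of A).mono ?_
  rintro _ ⟨⟨_, a, rfl⟩, rfl⟩
  obtain ⟨l, hl, h⟩ := D.exists_approximateUnit (s + t)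
  have := hl.neBot
  -- α_t(u) already lies in `A_t`, and ᾱ_s(1) is absorbed by α_s(α_t(u)) = α_{s+t}(u).
  have hp : ∀ u, (D.preMul s t (D.elt s a) (D.elt t (D.α t u)) : A) = a * D.α (s + t) u := by
    intro u
    rw [coe_preMul, coe_elt, coe_elt, mulOne_alpha, mulOne_mul_alpha, D.α_add]
  refine mem_closure_of_tendsto (f := fun u => of A (D.preMul s t (D.elt s a)
    (D.elt t (D.α t u)))) (b := l) (((D.continuous_of (s + t)).tendsto _).comp ?_)
    (Eventually.of_forall fun u => ⟨_, _, rfl⟩)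
  rw [tendsto_subtype_rng]
  simp only [hp]
  exact h a

/-- The map on the algebraic tensor product induced by the product. -/
def tensorMul (s t : S) : D.Fibre s ⊗[ℂ] D.Fibre t →ₗ[ℂ] D.Fibre (s + t) :=
  TensorProduct.lift (ContinuousLinearMap.toLinearMap₁₂ (D.fibreMul s t))

theorem tensorMul_tmul (s t : S) (x : D.Fibre s) (y : D.Fibre t) :
    D.tensorMul s t (x ⊗ₜ y) = D.fibreMul s t x y := rfl

/-- By sesquilinearity the inner product need only be compared on elementary tensors, where
`fibreMul_ip` applies. Balancedness over `A` needs no check of its own: (x · a) ⊗ y - x ⊗ (a · y)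
has length zero, so an isometry kills it. -/
theorem exists_tensor_iso (s t : S) :
    ∃ U : HilbertBimoduleIso A (InternalTensor A (D.Fibre s) (D.Fibre t)) (D.Fibre (s + t)),
      ∀ x y, U (InternalTensor.mk A x y) = D.fibreMul s t x y := by
  obtain ⟨U, hU⟩ := HilbertCompletion.exists_iso (A := A) (D.tensorMul s t)
    (fun z w => by
      induction z with
      | zero => simp
      | add z z' h h' => simp only [map_add, LinearMap.add_apply, h, h']
      | tmul x y =>
        induction w with
        | zero => simp
        | add z z' h h' => simp only [map_add, h, h']
        | tmul x' y' => exact D.fibreMul_ip s t x x' y y')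
    (fun z a => by
      induction z with
      | zero => simp
      | add z z' h h' => simp only [map_add, LinearMap.add_apply, h, h']
      | tmul x y => exact D.fibreMul_right s t x y a)
    (fun a z => by
      induction z with
      | zero => simp
      | add z z' h h' => simp only [map_add, h, h']
      | tmul x y => exact D.fibreMul_left s t a x y)
    ((D.dense_preMul s t).mono <| by
      rintro _ ⟨x, y, rfl⟩
      exact ⟨of A x ⊗ₜ of A y, by rw [tensorMul_tmul, fibreMul_of]⟩)
  exact ⟨U, fun x y => hU (x ⊗ₜ y)⟩

/-! ### Associativity -/

/-- The identification of equal fibres. -/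
def fibreCast {s t : S} (h : s = t) : D.Fibre s →L[ℂ] D.Fibre t :=
  h ▸ ContinuousLinearMap.id ℂ (D.Fibre s)

/-- Turns equality in the disjoint union, over indices that are equal but not definitionally so,
into an equation inside one fibre. As the cast is continuous, such an equation can be checked on a
dense subspace. -/
theorem sigma_mk_eq_iff {s t : S} (h : s = t) (x : D.Fibre s) (y : D.Fibre t) :
    (⟨s, x⟩ : Σ s, D.Fibre s) = ⟨t, y⟩ ↔ D.fibreCast h x = y := by
  subst h
  simp [fibreCast]

/-- All `A_s` sit inside the same `A`, so classes in fibres over equal indices can be compared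
through the underlying elements of `A`. -/
theorem fibreCast_of {s t : S} (h : s = t) (x : D.sub s) (y : D.sub t) (hxy : (x : A) = y) :
    D.fibreCast h (of A x) = of A y := by
  subst h
  rw [Subtype.ext hxy]
  rfl

/-- On representatives both sides are x α_s(y) α_{s+t}(z) = x α_s(y α_t(z)). -/
theorem fibreMul_assoc (s t r : S) (x : D.Fibre s) (y : D.Fibre t) (z : D.Fibre r) :
    D.fibreCast (add_assoc s t r) (D.fibreMul (s + t) r (D.fibreMul s t x y) z)
      = D.fibreMul s (t + r) x (D.fibreMul t r y z) := by
  induction x using induction_of with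
  | hp => apply isClosed_eq <;> fun_prop
  | ih x =>
  induction y using induction_of with
  | hp => apply isClosed_eq <;> fun_prop
  | ih y =>
  induction z using induction_of with
  | hp => apply isClosed_eq <;> fun_prop
  | ih z =>
    rw [fibreMul_of, fibreMul_of, fibreMul_of, fibreMul_of]
    refine D.fibreCast_of _ _ _ ?_
    simp only [coe_preMul, map_mul, D.α_add, mul_assoc]

theorem mul_mul_mul (x y z : Σ s, D.Fibre s) : D.mul (D.mul x y) z = D.mul x (D.mul y z) :=
  (D.sigma_mk_eq_iff (add_assoc x.1 y.1 z.1) _ _).2 (D.fibreMul_assoc _ _ _ x.2 y.2 z.2)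

/-! ### The fibre over 0 and essentiality -/

/-- For x in `A_s` the product is a ᾱ_0(1) α_0(x) = a x. -/
theorem cls_zero_mul (a : A) (s : S) (x : D.Fibre s) :
    D.mul ⟨0, D.cls 0 a⟩ ⟨s, x⟩ = ⟨s, left a x⟩ := by
  refine (D.sigma_mk_eq_iff (zero_add s) _ _).2 ?_
  change D.fibreCast _ (D.fibreMul 0 s (D.cls 0 a) x) = leftL A _ a x
  induction x using induction_of with
  | hp => apply isClosed_eq <;> fun_prop
  | ih x =>
    rw [← left_eq, left_of, cls, fibreMul_of]
    refine D.fibreCast_of _ _ _ ?_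
    rw [coe_preMul, coe_elt, mulOne_zero, D.α_zero, coe_left]

/-- For x in `A_s` the product is x α_s(a ᾱ_0(1)) = x α_s(a), the right action. -/
theorem mul_cls_zero (a : A) (s : S) (x : D.Fibre s) :
    D.mul ⟨s, x⟩ ⟨0, D.cls 0 a⟩ = ⟨s, right x a⟩ := by
  refine (D.sigma_mk_eq_iff (add_zero s) _ _).2 ?_
  change D.fibreCast _ (D.fibreMul s 0 x (D.cls 0 a)) = rightL A _ x a
  induction x using induction_of with
  | hp => apply isClosed_eq <;> fun_prop
  | ih x =>
    rw [← right_eq, right_of, cls, fibreMul_of]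
    refine D.fibreCast_of _ _ _ ?_
    rw [coe_preMul, coe_elt, mulOne_zero, coe_right]

/-- The map `a ↦ a ᾱ_0(1)` from `A` to `M_0`. -/
def clsZero : A →ₗ[ℂ] D.Fibre 0 :=
  (of A).comp ((D.mulOne 0).toLinearMap.rangeRestrict)

theorem exists_zero_iso : ∃ ι : HilbertBimoduleIso A A (D.Fibre 0), ∀ a, ι a = D.cls 0 a := by
  have hcls : ∀ a, D.clsZero a = of A (D.elt 0 a) := fun a => rfl
  refine ⟨HilbertBimoduleIso.ofDenseRange D.clsZero (fun a b => ?_) (fun a b => ?_) (fun a b => ?_)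
    ?_, fun a => rfl⟩
  · rw [hcls, hcls, ip_of, ip_sub, coe_elt, coe_elt, mulOne_zero, mulOne_zero, D.L_zero]
    rfl
  · rw [hcls, hcls, right_of]
    refine congrArg _ (Subtype.ext ?_)
    rw [coe_right, coe_elt, coe_elt, mulOne_zero, mulOne_zero, D.α_zero]
    rfl
  · rw [hcls, hcls, left_of]
    refine congrArg _ (Subtype.ext ?_)
    rw [coe_left, coe_elt, coe_elt, mulOne_zero, mulOne_zero]
    rfl
  · refine (denseRange_of A).mono ?_
    rintro _ ⟨⟨_, a, rfl⟩, rfl⟩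
    exact ⟨a, rfl⟩

theorem isEssential_fibre (s : S) : HilbertBimodule.IsEssential A (D.Fibre s) := by
  rw [HilbertBimodule.IsEssential, ← Submodule.dense_iff_topologicalClosure_eq_top, ← dense_closure]
  refine (denseRange_of A).mono ?_
  rintro _ ⟨x, rfl⟩
  obtain ⟨l, hl, -⟩ := D.exists_approximateUnit s
  have := hl.neBot
  -- Along an approximate unit u x → x in the norm of `A`, hence also in the fibre, and each u · x
  -- lies in the span.
  refine mem_closure_of_tendsto (f := fun u => of A (left u x)) (b := l)
    (((D.continuous_of s).tendsto _).comp ?_)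
    (Eventually.of_forall fun u => Submodule.subset_span ⟨u, of A x, (left_of A _ x u).symm⟩)
  rw [tendsto_subtype_rng]
  exact hl.tendsto_mul_right (x : A)

end TransferSystem

theorem mainTheorem6 {A : Type*} [NonUnitalCStarAlgebra A] [PartialOrder A] [StarOrderedRing A]
    {S : Type*} [AddCommMonoid S] (D : TransferSystem A S) :
    (∃ ι : HilbertBimoduleIso A A (D.Fibre 0),
      (∀ a : A, ι a = D.cls 0 a) ∧ IsProductSystem D.mul ι) ∧
    ∀ s : S, HilbertBimodule.IsEssential A (D.Fibre s) := by
  obtain ⟨ι, hι⟩ := D.exists_zero_iso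
  refine ⟨⟨ι, hι, ⟨D.mul_mul_mul, fun x y => rfl, fun s t _ _ => ?_, fun a s x => ?_,
    fun a s x => ?_⟩⟩, D.isEssential_fibre⟩
  · obtain ⟨U, hU⟩ := D.exists_tensor_iso s t
    exact ⟨U, fun x y => by rw [hU]; rfl⟩
  · rw [hι, D.cls_zero_mul]
  · rw [hι, D.mul_cls_zero]

end
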